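/- **Proposition 5.5.** Let $r, m, n$ be integers with $1 \le m \le n$, let $\Sigma \in \mathbb{R}^{r\times r}$ be symmetric positive definite, and let $S \sim \mathcal{W}_r(n,\Sigma)$ be a Wishart matrix with $n$ degrees of freedom; that is, $S$ is distributed as $XX^T$, where $X \in \mathbb{R}^{r\times n}$ has independent columns distributed as $\mathcal{N}_r(0,\Sigma)$. Let $I, J \subseteq \{1,\dots,r\}$ be two disjoint subsets with $|I| = |J| = m$, each listed in an arbitrary fixed order. Write $A_{IJ} = A_{I\times J}$ for the submatrix of $A$ with rows $I$ and columns $J$, $\Sigma_{IJ\times IJ}$ for the $(I\cup J)\times(I\cup J)$-submatrix of $\Sigma$, and $\Sigma^{IJ}$ for the $I\times J$-submatrix of the inverse of $\Sigma_{IJ\times IJ}$. For an $m\times m$ matrix $A$, let $A^{(k)}$ denote its $k$-th compound, that is, the matrix of all $k\times k$ minors $\det(A_{K\times L})$ with $K, L \subseteq \{1,\dots,m\}$, $|K| = |L| = k$ (so $A^{(0)} = 1$). Then the off-diagonal minor $\det(S_{IJ})$ has a finite second moment, and its variance is $$ \begin{aligned} \operatorname{Var}[\det(S_{IJ})] ={}&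 \frac{n!}{(n-m)!}\,\det(\Sigma_{IJ})^2\left\{\frac{(n+2)!}{(n+2-m)!}-\frac{n!}{(n-m)!}\right\}\\ &+\frac{n!}{(n-m)!}\,\det(\Sigma_{IJ\times IJ})\left(\sum_{k=0}^{m-1}(m-k)!\,\frac{(n+2)!}{(n+2-k)!}\,(-1)^k\operatorname{tr}\{(\Sigma_{JI}\Sigma^{IJ})^{(k)}\}\right). \end{aligned} $$ -/

import Mathlib

open MeasureTheory ProbabilityTheory Matrix
open scoped Nat

noncomputable section

/-- The product (equivalently Borel) σ-algebra on the space of real matrices. -/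
instance matrixMeasurableSpace (p q : ℕ) : MeasurableSpace (Matrix (Fin p) (Fin q) ℝ) :=
  inferInstanceAs (MeasurableSpace (Fin p → Fin q → ℝ))

/-- The `r × n` matrix with columns `x 0, …, x (n - 1)`. -/
def columnMatrix {r n : ℕ} (x : Fin n → EuclideanSpace ℝ (Fin r)) : Matrix (Fin r) (Fin n) ℝ :=
  Matrix.of fun i j => x j i

/-- The Wishart distribution `W_r(n, Γ)` with scale matrix `Γ` and `n` degrees of freedom: the law
of `X Xᵀ`, where the `n` columns of `X` are independent centred Gaussian vectors with covariance
matrix `Γ`. -/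
def wishart {r : ℕ} (n : ℕ) (Γ : Matrix (Fin r) (Fin r) ℝ) :
    Measure (Matrix (Fin r) (Fin r) ℝ) :=
  (Measure.pi fun _ : Fin n => multivariateGaussian (0 : EuclideanSpace ℝ (Fin r)) Γ).map
    fun x => columnMatrix x * (columnMatrix x)ᵀ

/-- The submatrix `A_{I × J}`, whose rows and columns are listed in the orders `a` and `b` chosen on
the index sets `I` and `J`. -/
def blockOf {r m : ℕ} (A : Matrix (Fin r) (Fin r) ℝ) {I J : Finset (Fin r)}
    (a : Fin m ≃ I) (b : Fin m ≃ J) : Matrix (Fin m) (Fin m) ℝ :=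
  A.submatrix (fun i => (a i : Fin r)) (fun j => (b j : Fin r))

/-- The principal submatrix `A_{K × K}`. -/
def principalBlock {r : ℕ} (A : Matrix (Fin r) (Fin r) ℝ) (K : Finset (Fin r)) : Matrix K K ℝ :=
  A.submatrix (fun i => (i : Fin r)) (fun j => (j : Fin r))

/-- The `I × J` block of the inverse of the principal submatrix `A_{(I ∪ J) × (I ∪ J)}`. -/
def inverseBlock {r m : ℕ} (A : Matrix (Fin r) (Fin r) ℝ) {I J : Finset (Fin r)}
    (a : Fin m ≃ I) (b : Fin m ≃ J) : Matrix (Fin m) (Fin m) ℝ :=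
  ((principalBlock A (I ∪ J))⁻¹).submatrix
    (fun i => ⟨(a i : Fin r), Finset.mem_union_left J (a i).2⟩)
    (fun j => ⟨(b j : Fin r), Finset.mem_union_right I (b j).2⟩)

/-- The `k`-th compound `A^(k)` of `A`: the matrix of all `k × k` minors of `A`, indexed by the
`k`-element subsets of the index set, each listed in increasing order. -/
def compound {m : ℕ} (k : ℕ) (A : Matrix (Fin m) (Fin m) ℝ) :
    Matrix {K : Finset (Fin m) // K.card = k} {L : Finset (Fin m) // L.card = k} ℝ :=
  Matrix.of fun K L => (A.submatrix (K.1.orderEmbOfFin K.2) (L.1.orderEmbOfFin L.2)).det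

end

/-! Write `Σ_{IJ×IJ} = M Mᵀ` with `M` block lower triangular, with blocks `P`, `R C`, `R`. Then the
rows of `X` indexed by `I` and `J` have the joint law of `P U` and `R (C U + V)`, where `U`, `V` are
independent `m × n` arrays of standard normals, and `det S_{IJ}` has the law of `det P · det R · det
((C U + V) Uᵀ)` (`map_det_blockOf_wishart`). An orthogonal change of `P` makes `Cᵀ C` diagonal
(`exists_block_factorization`).

Given `U`, take a square `T` with `T Tᵀ = U Uᵀ`. Then `V Uᵀ` has the law of `V' Tᵀ` with `V'`
square, so the determinant behaves like `det (C T + V') · det T`. The second moment of `det (A +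
V')` is a combination, with weights `(m - k)!`, of the sums of principal `k × k` minors of `A Aᵀ`
(`integral_det_add_sq_stdNormalMat`).

Since `Cᵀ C` is diagonal, what remains is the expectation of products of two nested Gram
determinants of rows of `U`. These are integrated one row at a time: as a function of one row, a
Gram determinant is a multiple of the squared distance to the span of the others
(`gramDet_update_insert`). Hence the falling factorials of `n` and `n + 2`.

Block inversion turns the minors of `Cᵀ C` into those of `Σ_{JI} Σ^{IJ}`, up to `(-1)^k`. The term
`k = m` is `det(Σ_{IJ})²` after scaling; together with the squared mean it gives the first line of
the formula. -/

/-- A real random variable with finite absolute moments of every order. -/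
def HasMoments {α : Type*} [MeasurableSpace α] (f : α → ℝ) (μ : Measure α) : Prop :=
  ∀ p : NNReal, MemLp f p μ

/-! ### The algebra of random variables with all moments, which makes integrability automatic -/

namespace HasMoments

variable {α β : Type*} [MeasurableSpace α] [MeasurableSpace β] {μ : Measure α} {f g : α → ℝ}

theorem const [IsFiniteMeasure μ] (c : ℝ) : HasMoments (fun _ => c) μ := fun _ => memLp_const c

theorem add (hf : HasMoments f μ) (hg : HasMoments g μ) : HasMoments (fun x => f x + g x) μ :=
  fun p => (hf p).add (hg p)

theorem mul (hf : HasMoments f μ) (hg : HasMoments g μ) : HasMoments (fun x => f x * g x) μ := by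
  intro p
  -- Hölder with exponents `2p, 2p, p`: closure under products needs all moments at once.
  have : ENNReal.HolderTriple ((2 * p : NNReal) : ENNReal) ((2 * p : NNReal) : ENNReal) p := by
    constructor
    rw [ENNReal.coe_mul, ENNReal.mul_inv (by simp) (by simp), ← two_mul, ← mul_assoc]
    simp [ENNReal.mul_inv_cancel]
  exact (hg (2 * p)).mul' (hf (2 * p))

theorem pow [IsFiniteMeasure μ] (hf : HasMoments f μ) (k : ℕ) : HasMoments (fun x => f x ^ k) μ := by
  induction k with
  | zero => simpa using const 1
  | succ k ih => simpa only [pow_succ] using ih.mul hf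

theorem sum {ι : Type*} (s : Finset ι) {F : ι → α → ℝ} (h : ∀ i, HasMoments (F i) μ) :
    HasMoments (fun x => ∑ i ∈ s, F i x) μ := fun p =>
  memLp_finsetSum s fun i _ => h i p

theorem prod [IsFiniteMeasure μ] {ι : Type*} (s : Finset ι) {F : ι → α → ℝ}
    (h : ∀ i, HasMoments (F i) μ) : HasMoments (fun x => ∏ i ∈ s, F i x) μ := by
  classical
  induction s using Finset.induction_on with
  | empty => simpa using const 1
  | insert i s hi ih => simpa only [Finset.prod_insert hi] using (h i).mul ih

theorem dotProduct {ι : Type*} [Fintype ι] {F G : α → ι → ℝ}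
    (hF : ∀ i, HasMoments (fun x => F x i) μ) (hG : ∀ i, HasMoments (fun x => G x i) μ) :
    HasMoments (fun x => F x ⬝ᵥ G x) μ :=
  sum _ fun i => (hF i).mul (hG i)

theorem det [IsFiniteMeasure μ] {ι : Type*} [Fintype ι] [DecidableEq ι] {M : α → Matrix ι ι ℝ}
    (h : ∀ i j, HasMoments (fun x => M x i j) μ) : HasMoments (fun x => (M x).det) μ := by
  simp only [Matrix.det_apply']
  exact sum _ fun σ => (const _).mul (prod _ fun i => h _ _)

theorem comp_measurePreserving {ν : Measure β} {f : β → ℝ} (hf : HasMoments f ν) {T : α → β}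
    (hT : MeasurePreserving T μ ν) : HasMoments (fun x => f (T x)) μ :=
  fun p => (hf p).comp_measurePreserving hT

theorem integrable (hf : HasMoments f μ) : Integrable f μ :=
  memLp_one_iff_integrable.1 (by simpa using hf 1)

theorem memLp_two (hf : HasMoments f μ) : MemLp f 2 μ := by simpa using hf 2

end HasMoments

/-! ### Product measures: resampling a coordinate, transposing an array -/

/-- On a box, the preimage leaves coordinate `i` of the old point free and constrains the new value
instead. This yields Fubini in a form that integrates out one row in place. -/
theorem measurePreserving_update {ι : Type*} [Fintype ι] [DecidableEq ι] {α : ι → Type*}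
    [∀ i, MeasurableSpace (α i)] (μ : ∀ i, Measure (α i)) [∀ i, IsProbabilityMeasure (μ i)]
    (i : ι) :
    MeasurePreserving (fun p : (∀ j, α j) × α i => Function.update p.1 i p.2)
      ((Measure.pi μ).prod (μ i)) (Measure.pi μ) := by
  have hm : Measurable (fun p : (∀ j, α j) × α i => Function.update p.1 i p.2) :=
    measurable_update'
  refine ⟨hm, (Measure.pi_eq fun s hs => ?_).symm⟩
  rw [Measure.map_apply hm (MeasurableSet.univ_pi hs)]
  have : (fun p : (∀ j, α j) × α i => Function.update p.1 i p.2) ⁻¹' Set.univ.pi s =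
      (Set.univ.pi (Function.update s i Set.univ)) ×ˢ s i := by
    ext ⟨x, y⟩
    simp only [Set.mem_preimage, Set.mem_pi, Set.mem_univ, forall_const, Set.mem_prod]
    constructor
    · intro h
      refine ⟨fun j => ?_, by simpa using h i⟩
      by_cases hj : j = i
      · subst hj; simp
      · simpa [hj] using h j
    · rintro ⟨h, h'⟩ j
      by_cases hj : j = i
      · subst hj; simpa using h'
      · simpa [hj] using h j
  rw [this, Measure.prod_prod, Measure.pi_pi, ← Finset.prod_erase_mul _ _ (Finset.mem_univ i),
    ← Finset.prod_erase_mul (a := i) Finset.univ (fun i => μ i (s i)) (Finset.mem_univ i)]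
  congr 1
  simp only [Function.update_self, measure_univ, mul_one]
  refine Finset.prod_congr rfl fun j hj => ?_
  rw [Function.update_of_ne (Finset.ne_of_mem_erase hj)]

theorem integral_pi_eq_integral_update {ι : Type*} [Fintype ι] [DecidableEq ι] {α : ι → Type*}
    [∀ i, MeasurableSpace (α i)] (μ : ∀ i, Measure (α i)) [∀ i, IsProbabilityMeasure (μ i)]
    (i : ι) {f : (∀ j, α j) → ℝ} (hf : Integrable f (Measure.pi μ)) :
    ∫ x, f x ∂Measure.pi μ = ∫ x, ∫ y, f (Function.update x i y) ∂μ i ∂Measure.pi μ := by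
  have h := measurePreserving_update μ i
  have hf' : Integrable (fun p : (∀ j, α j) × α i => f (Function.update p.1 i p.2))
      ((Measure.pi μ).prod (μ i)) := h.integrable_comp_of_integrable hf
  rw [← integral_prod _ hf', ← integral_map (f := f) h.measurable.aemeasurable
    (by rw [h.map_eq]; exact hf.aestronglyMeasurable), h.map_eq]

/-- On boxes of boxes this is the interchange of two finite products. It passes from independent
columns, as in the Wishart law, to independent rows, as in the moment computations. -/
theorem measurePreserving_swap_pi {ι κ α : Type*} [Fintype ι] [Fintype κ] [MeasurableSpace α]
    (μ : Measure α) [IsProbabilityMeasure μ] :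
    MeasurePreserving (fun (x : ι → κ → α) k i => x i k)
      (Measure.pi fun _ => Measure.pi fun _ => μ) (Measure.pi fun _ => Measure.pi fun _ => μ) := by
  have hm : Measurable (fun (x : ι → κ → α) k i => x i k) := by fun_prop
  refine ⟨hm, (Measure.pi_eq_generateFrom
    (C := fun _ => Set.pi Set.univ '' Set.pi Set.univ fun _ => {s | MeasurableSet s})
    (fun _ => generateFrom_pi) (fun _ => isPiSystem_pi)
    (fun _ => ⟨fun _ => Set.univ, fun _ => ⟨fun _ => Set.univ, by simp, by simp⟩, by simp,
      by simp [Set.iUnion_const]⟩) fun s hs => ?_).symm⟩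
  choose t ht hts using hs
  have hms : MeasurableSet (Set.univ.pi s) := by
    refine MeasurableSet.univ_pi fun k => ?_
    rw [← hts k]
    exact MeasurableSet.univ_pi fun i => ht k i trivial
  have : (fun (x : ι → κ → α) k i => x i k) ⁻¹' Set.univ.pi s =
      Set.univ.pi fun i => Set.univ.pi fun k => t k i := by
    ext x
    simp only [← hts, Set.mem_preimage, Set.mem_pi, Set.mem_univ, forall_const]
    exact forall_comm
  rw [Measure.map_apply hm hms, this, Measure.pi_pi]
  simp only [Measure.pi_pi, ← hts]
  exact Finset.prod_comm

/-! ### Standard normal vectors: linear images and moments of quadratic forms -/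

/-- The law of a vector of independent standard normal variables indexed by `κ`. -/
noncomputable def stdNormalVec (κ : Type*) [Fintype κ] : Measure (κ → ℝ) :=
  Measure.pi fun _ => gaussianReal 0 1

instance (κ : Type*) [Fintype κ] : IsProbabilityMeasure (stdNormalVec κ) := by
  unfold stdNormalVec; infer_instance

/-- The law of an `ι × κ` array of independent standard normal variables. -/
noncomputable def stdNormalMat (ι κ : Type*) [Fintype ι] [Fintype κ] : Measure (ι → κ → ℝ) :=
  Measure.pi fun _ => stdNormalVec κ

instance (ι κ : Type*) [Fintype ι] [Fintype κ] : IsProbabilityMeasure (stdNormalMat ι κ) := by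
  unfold stdNormalMat; infer_instance

theorem exists_orthogonal_diagonalization {ι : Type*} [Fintype ι] [DecidableEq ι]
    {A : Matrix ι ι ℝ} (hA : A.IsSymm) :
    ∃ (O : Matrix ι ι ℝ) (l : ι → ℝ), O * Oᵀ = 1 ∧ Oᵀ * A * O = diagonal l := by
  have hH : A.IsHermitian := by
    rwa [IsHermitian, conjTranspose_eq_transpose_of_trivial]
  set O : Matrix ι ι ℝ := (hH.eigenvectorUnitary : Matrix ι ι ℝ)
  set l := hH.eigenvalues
  have hO1 : O * Oᵀ = 1 := by
    have := Unitary.mul_star_self_of_mem hH.eigenvectorUnitary.2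
    rwa [star_eq_conjTranspose, conjTranspose_eq_transpose_of_trivial] at this
  have hO2 : Oᵀ * O = 1 := mul_eq_one_comm.1 hO1
  have hs : A = O * diagonal l * Oᵀ := by
    have := hH.spectral_theorem
    rw [Unitary.conjStarAlgAut_apply] at this
    simpa [star_eq_conjTranspose, conjTranspose_eq_transpose_of_trivial] using this
  refine ⟨O, l, hO1, ?_⟩
  rw [hs]
  calc Oᵀ * (O * diagonal l * Oᵀ) * O = (Oᵀ * O) * diagonal l * (Oᵀ * O) := by
        simp only [Matrix.mul_assoc]
    _ = diagonal l := by rw [hO2, Matrix.one_mul, Matrix.mul_one]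

section

variable {ι κ κ' : Type*} [Fintype ι] [Fintype κ] [Fintype κ']

theorem map_toLp_stdNormalVec :
    (stdNormalVec κ).map (WithLp.toLp 2) = stdGaussian (EuclideanSpace ℝ κ) :=
  map_pi_eq_stdGaussian

theorem charFun_map_mulVec_stdNormalVec (M : Matrix ι κ ℝ) (t : EuclideanSpace ℝ ι) :
    charFun ((stdNormalVec κ).map fun v => WithLp.toLp 2 (M *ᵥ v)) t =
      Complex.exp (-((t.ofLp ⬝ᵥ (M * Mᵀ) *ᵥ t.ofLp : ℝ) : ℂ) / 2) := by
  have h := charFun_stdGaussian (E := EuclideanSpace ℝ κ) (WithLp.toLp 2 (Mᵀ *ᵥ t.ofLp))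
  rw [← map_toLp_stdNormalVec, charFun_apply, integral_map (by fun_prop) (by fun_prop)] at h
  rw [charFun_apply, integral_map (by fun_prop) (by fun_prop)]
  have hn : ‖(WithLp.toLp 2 (Mᵀ *ᵥ t.ofLp) : EuclideanSpace ℝ κ)‖ ^ 2 =
      t.ofLp ⬝ᵥ (M * Mᵀ) *ᵥ t.ofLp := by
    rw [EuclideanSpace.real_norm_sq_eq, ← mulVec_mulVec, dotProduct_mulVec, ← mulVec_transpose]
    simp [dotProduct, pow_two]
  rw [← hn]
  push_cast
  rw [← h]
  refine integral_congr_ae (Filter.Eventually.of_forall fun v => ?_)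
  simp only [EuclideanSpace.inner_eq_star_dotProduct, star_trivial]
  rw [mulVec_transpose, ← dotProduct_mulVec]

/-- The characteristic function of `M v` involves `M` only through `M Mᵀ`. The numbers of columns
may differ, so a rectangular factor can be traded for a square one. -/
theorem map_mulVec_stdNormalVec_congr {M : Matrix ι κ ℝ} {M' : Matrix ι κ' ℝ}
    (h : M * Mᵀ = M' * M'ᵀ) :
    (stdNormalVec κ).map (M *ᵥ ·) = (stdNormalVec κ').map (M' *ᵥ ·) := by
  have key : (stdNormalVec κ).map (fun v => WithLp.toLp 2 (M *ᵥ v)) =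
      (stdNormalVec κ').map (fun v => WithLp.toLp 2 (M' *ᵥ v)) := by
    have : IsProbabilityMeasure ((stdNormalVec κ).map (fun v => WithLp.toLp 2 (M *ᵥ v))) :=
      Measure.isProbabilityMeasure_map (by fun_prop)
    have : IsProbabilityMeasure ((stdNormalVec κ').map (fun v => WithLp.toLp 2 (M' *ᵥ v))) :=
      Measure.isProbabilityMeasure_map (by fun_prop)
    apply Measure.ext_of_charFun
    ext t
    rw [charFun_map_mulVec_stdNormalVec, charFun_map_mulVec_stdNormalVec, h]
  have := congrArg (Measure.map (WithLp.ofLp : EuclideanSpace ℝ ι → ι → ℝ)) key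
  rwa [Measure.map_map (by fun_prop) (by fun_prop), Measure.map_map (by fun_prop) (by fun_prop)]
    at this

open scoped MatrixOrder in
theorem map_mulVec_multivariateGaussian [DecidableEq ι] {Γ : Matrix ι ι ℝ} (hΓ : Γ.PosSemidef)
    {A : Matrix κ ι ℝ} {M : Matrix κ κ' ℝ} (h : A * Γ * Aᵀ = M * Mᵀ) :
    (multivariateGaussian 0 Γ).map (fun x => A *ᵥ x.ofLp) = (stdNormalVec κ').map (M *ᵥ ·) := by
  have hs : CFC.sqrt Γ * CFC.sqrt Γ = Γ := CFC.sqrt_mul_sqrt_self _ hΓ.nonneg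
  have ht : (CFC.sqrt Γ)ᵀ = CFC.sqrt Γ := by
    have := (CFC.sqrt_nonneg Γ).isSelfAdjoint
    simpa [IsSelfAdjoint, star_eq_conjTranspose, conjTranspose_eq_transpose_of_trivial] using this
  rw [← map_mulVec_stdNormalVec_congr (M := A * CFC.sqrt Γ) (M' := M), multivariateGaussian,
    ← map_toLp_stdNormalVec, Measure.map_map (by fun_prop) (by fun_prop),
    Measure.map_map (by fun_prop) (by fun_prop)]
  · congr 1
    ext v : 1
    simp [mulVec_mulVec]
  · rw [← h, transpose_mul, ht, ← Matrix.mul_assoc, Matrix.mul_assoc A, hs]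

theorem measurePreserving_eval_stdNormalVec (i : κ) :
    MeasurePreserving (fun v : κ → ℝ => v i) (stdNormalVec κ) (gaussianReal 0 1) :=
  measurePreserving_eval _ i

theorem measurePreserving_eval_stdNormalMat (i : ι) :
    MeasurePreserving (fun v : ι → κ → ℝ => v i) (stdNormalMat ι κ) (stdNormalVec κ) :=
  measurePreserving_eval _ i

theorem hasMoments_id_gaussianReal : HasMoments (fun x => x) (gaussianReal 0 1) :=
  fun p => memLp_id_gaussianReal p

theorem hasMoments_stdNormalVec (i : κ) : HasMoments (fun v : κ → ℝ => v i) (stdNormalVec κ) :=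
  hasMoments_id_gaussianReal.comp_measurePreserving (measurePreserving_eval_stdNormalVec i)

theorem hasMoments_stdNormalMat (i : ι) (k : κ) :
    HasMoments (fun v : ι → κ → ℝ => v i k) (stdNormalMat ι κ) :=
  (hasMoments_stdNormalVec k).comp_measurePreserving (measurePreserving_eval_stdNormalMat i)

theorem integral_stdNormalVec_apply (i : κ) : ∫ v, v i ∂stdNormalVec κ = 0 := by
  have := integral_comp_eval (μ := fun _ : κ => gaussianReal 0 1) (i := i) (f := fun x : ℝ => x)
    (by fun_prop)
  rw [stdNormalVec, this]
  simp

theorem integral_sq_gaussianReal : ∫ x, x ^ 2 ∂gaussianReal 0 1 = 1 := by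
  have := variance_fun_id_gaussianReal (μ := 0) (v := 1)
  rw [variance_eq_integral (by fun_prop)] at this
  simpa using this

/-- Cubic coefficients suffice for the fourth moment: the first three derivatives of `exp (t² / 2)`
have this shape, and the fourth is only evaluated at `0`. -/
theorem deriv_poly_mul_exp_sq (a b c d : ℝ) :
    deriv (fun t : ℝ => (a + b * t + c * t ^ 2 + d * t ^ 3) * Real.exp (t ^ 2 / 2)) =
      fun t => ((b + 2 * c * t + 3 * d * t ^ 2) + (a + b * t + c * t ^ 2 + d * t ^ 3) * t) *
        Real.exp (t ^ 2 / 2) := by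
  ext t
  have h1 : HasDerivAt (fun t : ℝ => Real.exp (t ^ 2 / 2)) (Real.exp (t ^ 2 / 2) * t) t := by
    refine ((hasDerivAt_pow 2 t).div_const 2).exp.congr_deriv ?_
    norm_num
  have h2 : HasDerivAt (fun t : ℝ => a + b * t + c * t ^ 2 + d * t ^ 3)
      (b + 2 * c * t + 3 * d * t ^ 2) t := by
    refine (((((hasDerivAt_id t).const_mul b).const_add a).add
      ((hasDerivAt_pow 2 t).const_mul c)).add ((hasDerivAt_pow 3 t).const_mul d)).congr_deriv ?_
    norm_num
    ring
  refine (h2.mul h1).deriv.trans ?_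
  ring

theorem integral_pow_four_gaussianReal : ∫ x, x ^ 4 ∂gaussianReal 0 1 = 3 := by
  have h := iteratedDeriv_mgf_zero (X := id) (μ := gaussianReal 0 1)
    (by simp [integrableExpSet_id_gaussianReal]) 4
  have e0 : mgf id (gaussianReal 0 1) =
      fun t : ℝ => (1 + 0 * t + 0 * t ^ 2 + 0 * t ^ 3) * Real.exp (t ^ 2 / 2) := by
    rw [mgf_id_gaussianReal]; ext t; simp
  have e1 : deriv (mgf id (gaussianReal 0 1)) =
      fun t : ℝ => (0 + 1 * t + 0 * t ^ 2 + 0 * t ^ 3) * Real.exp (t ^ 2 / 2) := by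
    rw [e0, deriv_poly_mul_exp_sq]; ext t; ring
  have e2 : deriv (deriv (mgf id (gaussianReal 0 1))) =
      fun t : ℝ => (1 + 0 * t + 1 * t ^ 2 + 0 * t ^ 3) * Real.exp (t ^ 2 / 2) := by
    rw [e1, deriv_poly_mul_exp_sq]; ext t; ring
  have e3 : deriv (deriv (deriv (mgf id (gaussianReal 0 1)))) =
      fun t : ℝ => (0 + 3 * t + 0 * t ^ 2 + 1 * t ^ 3) * Real.exp (t ^ 2 / 2) := by
    rw [e2, deriv_poly_mul_exp_sq]; ext t; ring
  simp only [iteratedDeriv_succ, iteratedDeriv_zero] at h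
  rw [e3, deriv_poly_mul_exp_sq] at h
  simpa using h.symm

theorem integral_apply_stdNormalVec {f : ℝ → ℝ} (hf : HasMoments f (gaussianReal 0 1)) (i : κ) :
    ∫ v, f (v i) ∂stdNormalVec κ = ∫ x, f x ∂gaussianReal 0 1 :=
  integral_comp_eval (μ := fun _ : κ => gaussianReal 0 1) hf.integrable.aestronglyMeasurable

theorem integral_apply_mul_apply_stdNormalVec [DecidableEq κ] {f g : ℝ → ℝ}
    (hf : HasMoments f (gaussianReal 0 1)) (hg : HasMoments g (gaussianReal 0 1))
    {i j : κ} (hij : i ≠ j) :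
    ∫ v, f (v i) * g (v j) ∂stdNormalVec κ =
      (∫ x, f x ∂gaussianReal 0 1) * ∫ x, g x ∂gaussianReal 0 1 := by
  have hi := ((hf.comp_measurePreserving (measurePreserving_eval_stdNormalVec i)).mul
    (hg.comp_measurePreserving (measurePreserving_eval_stdNormalVec j))).integrable
  rw [← integral_apply_stdNormalVec hg j, stdNormalVec, integral_pi_eq_integral_update _ i hi,
    ← integral_const_mul]
  simp [hij.symm, integral_mul_const]

theorem integral_mul_stdNormalVec [DecidableEq κ] (i j : κ) :
    ∫ v, v i * v j ∂stdNormalVec κ = if i = j then 1 else 0 := by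
  split_ifs with h
  · subst h
    simp only [← pow_two]
    rw [integral_apply_stdNormalVec (hasMoments_id_gaussianReal.pow 2), integral_sq_gaussianReal]
  · rw [integral_apply_mul_apply_stdNormalVec hasMoments_id_gaussianReal
      hasMoments_id_gaussianReal h]
    simp

theorem integral_sq_mul_sq_stdNormalVec [DecidableEq κ] (i j : κ) :
    ∫ v, v i ^ 2 * v j ^ 2 ∂stdNormalVec κ = if i = j then 3 else 1 := by
  have h2 := hasMoments_id_gaussianReal.pow 2
  split_ifs with h
  · subst h
    simp only [← pow_add]
    rw [integral_apply_stdNormalVec (hasMoments_id_gaussianReal.pow (2 + 2)),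
      integral_pow_four_gaussianReal]
  · rw [integral_apply_mul_apply_stdNormalVec h2 h2 h, integral_sq_gaussianReal, one_mul]

theorem integral_add_quadraticForm_stdNormalVec [DecidableEq κ] (A : Matrix κ κ ℝ) (a : κ → ℝ) :
    ∫ v, (a + v) ⬝ᵥ A *ᵥ (a + v) ∂stdNormalVec κ = a ⬝ᵥ A *ᵥ a + A.trace := by
  have hm (i : κ) := hasMoments_stdNormalVec i
  have e (v : κ → ℝ) : (a + v) ⬝ᵥ A *ᵥ (a + v) = ∑ i, ∑ j,
      (a i * A i j * a j + a i * A i j * v j + A i j * a j * v i + A i j * (v i * v j)) := by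
    simp only [dotProduct, mulVec, Finset.mul_sum, Pi.add_apply]
    refine Finset.sum_congr rfl fun i _ => Finset.sum_congr rfl fun j _ => ?_
    ring
  have i1 (i j : κ) : Integrable (fun v : κ → ℝ => a i * A i j * v j) (stdNormalVec κ) :=
    (hm j).integrable.const_mul _
  have i2 (i j : κ) : Integrable (fun v : κ → ℝ => A i j * a j * v i) (stdNormalVec κ) :=
    (hm i).integrable.const_mul _
  have i3 (i j : κ) : Integrable (fun v : κ → ℝ => A i j * (v i * v j)) (stdNormalVec κ) :=
    ((hm i).mul (hm j)).integrable.const_mul _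
  have i5 (i j : κ) : Integrable (fun v : κ → ℝ => a i * A i j * a j + a i * A i j * v j)
      (stdNormalVec κ) := (integrable_const _).add (i1 i j)
  have i6 (i j : κ) : Integrable (fun v : κ → ℝ => a i * A i j * a j + a i * A i j * v j +
      A i j * a j * v i) (stdNormalVec κ) := (i5 i j).add (i2 i j)
  have i4 (i j : κ) : Integrable (fun v : κ → ℝ => a i * A i j * a j + a i * A i j * v j +
      A i j * a j * v i + A i j * (v i * v j)) (stdNormalVec κ) :=
    (i6 i j).add (i3 i j)
  simp only [e]
  rw [integral_finsetSum _ fun i _ => integrable_finsetSum _ fun j _ => i4 i j]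
  simp_rw [integral_finsetSum _ fun j _ => i4 _ j]
  have (i j : κ) : ∫ v : κ → ℝ, (a i * A i j * a j + a i * A i j * v j +
      A i j * a j * v i + A i j * (v i * v j)) ∂stdNormalVec κ =
      a i * A i j * a j + A i j * if i = j then 1 else 0 := by
    rw [integral_add (i6 i j) (i3 i j), integral_add (i5 i j) (i2 i j),
      integral_add (integrable_const _) (i1 i j)]
    simp only [integral_const_mul, integral_stdNormalVec_apply, integral_mul_stdNormalVec]
    simp
  simp only [this, Finset.sum_add_distrib]
  simp [dotProduct, mulVec, Finset.mul_sum, trace, mul_assoc]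

theorem integral_comp_mulVec_orthogonal [DecidableEq κ] {O : Matrix κ κ ℝ} (hO : O * Oᵀ = 1)
    {f : (κ → ℝ) → ℝ} (hf : Measurable f) :
    ∫ v, f (O *ᵥ v) ∂stdNormalVec κ = ∫ v, f v ∂stdNormalVec κ := by
  have h := map_mulVec_stdNormalVec_congr (M := O) (M' := (1 : Matrix κ κ ℝ)) (by simp [hO])
  rw [← integral_map (f := f) (by fun_prop) (by fun_prop), h]
  simp

/-- Rotation invariance reduces to a diagonal form `∑ l i * v i ^ 2`; the term `2 tr A²` is the
excess of `E v⁴ = 3` over `1` on the diagonal. -/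
theorem integral_quadraticForm_sq_stdNormalVec [DecidableEq κ] {A : Matrix κ κ ℝ}
    (hA : A.IsSymm) :
    ∫ v, (v ⬝ᵥ A *ᵥ v) ^ 2 ∂stdNormalVec κ = A.trace ^ 2 + 2 * (A * A).trace := by
  obtain ⟨O, l, hO1, hl⟩ := exists_orthogonal_diagonalization hA
  have hO2 : Oᵀ * O = 1 := mul_eq_one_comm.1 hO1
  have hs : A = O * diagonal l * Oᵀ := by
    rw [← hl]
    calc A = (O * Oᵀ) * A * (O * Oᵀ) := by rw [hO1, Matrix.one_mul, Matrix.mul_one]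
      _ = _ := by simp only [Matrix.mul_assoc]
  have hq (v : κ → ℝ) : (O *ᵥ v) ⬝ᵥ A *ᵥ (O *ᵥ v) = ∑ i, l i * v i ^ 2 := by
    have : A *ᵥ (O *ᵥ v) = O *ᵥ (diagonal l *ᵥ v) := by
      rw [mulVec_mulVec, mulVec_mulVec, hs, Matrix.mul_assoc, hO2, Matrix.mul_one]
    rw [this, dotProduct_mulVec, vecMul_mulVec, hO2]
    simp [dotProduct, mulVec_diagonal, pow_two, mul_left_comm]
  have ht : A.trace = ∑ i, l i := by
    rw [hs, trace_mul_comm, ← Matrix.mul_assoc, hO2, Matrix.one_mul, trace_diagonal]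
  have ht2 : (A * A).trace = ∑ i, l i * l i := by
    have : A * A = O * (diagonal l * diagonal l) * Oᵀ := by
      rw [hs]
      calc _ = O * diagonal l * (Oᵀ * O) * diagonal l * Oᵀ := by simp only [Matrix.mul_assoc]
        _ = _ := by rw [hO2]; simp only [Matrix.mul_assoc, Matrix.one_mul]
    rw [this, trace_mul_comm, ← Matrix.mul_assoc, hO2, Matrix.one_mul, diagonal_mul_diagonal,
      trace_diagonal]
  have hm : Measurable fun v : κ → ℝ => (v ⬝ᵥ A *ᵥ v) ^ 2 := by
    unfold dotProduct mulVec; fun_prop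
  rw [← integral_comp_mulVec_orthogonal hO1 hm, ht, ht2]
  simp only [hq]
  have e (v : κ → ℝ) : (∑ i, l i * v i ^ 2) ^ 2 =
      ∑ i, ∑ j, l i * l j * (v i ^ 2 * v j ^ 2) := by
    rw [pow_two, Finset.sum_mul_sum]
    refine Finset.sum_congr rfl fun i _ => Finset.sum_congr rfl fun j _ => ?_
    ring
  have i1 (i j : κ) : Integrable (fun v : κ → ℝ => l i * l j * (v i ^ 2 * v j ^ 2))
      (stdNormalVec κ) :=
    (((hasMoments_stdNormalVec i).pow 2).mul
      ((hasMoments_stdNormalVec j).pow 2)).integrable.const_mul _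
  simp only [e]
  rw [integral_finsetSum _ fun i _ => integrable_finsetSum _ fun j _ => i1 i j]
  simp_rw [integral_finsetSum _ fun j _ => i1 _ j, integral_const_mul,
    integral_sq_mul_sq_stdNormalVec]
  rw [pow_two, Finset.sum_mul_sum, Finset.mul_sum, ← Finset.sum_add_distrib]
  refine Finset.sum_congr rfl fun i _ => ?_
  have (j : κ) : l i * l j * (if i = j then (3 : ℝ) else 1) =
      l i * l j + if i = j then 2 * (l i * l i) else 0 := by
    split_ifs with h
    · subst h; ring
    · ring
  simp [this, Finset.sum_add_distrib]

end

/-! ### Gram determinants as quadratic forms in one row -/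

/-- The determinant of the Gram matrix of the rows `R i`, `i ∈ s`. -/
noncomputable def gramDet {ι κ : Type*} [DecidableEq ι] [Fintype κ] (R : ι → κ → ℝ)
    (s : Finset ι) : ℝ :=
  (Matrix.of fun i j : s => R i ⬝ᵥ R j).det

section

variable {ι κ : Type*} [DecidableEq ι] [Fintype κ]

theorem gramDet_empty (R : ι → κ → ℝ) : gramDet R ∅ = 1 := by
  simp [gramDet]

theorem gramDet_congr {R R' : ι → κ → ℝ} {s : Finset ι} (h : ∀ i ∈ s, R i = R' i) :
    gramDet R s = gramDet R' s := by
  unfold gramDet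
  congr 2
  ext i j
  rw [h i i.2, h j j.2]

theorem gramDet_update_of_notMem (R : ι → κ → ℝ) {s : Finset ι} {i : ι} (hi : i ∉ s)
    (v : κ → ℝ) : gramDet (Function.update R i v) s = gramDet R s :=
  gramDet_congr fun _ hj => Function.update_of_ne (ne_of_mem_of_not_mem hj hi) _ _

theorem HasMoments.gramDet {α : Type*} [MeasurableSpace α] {μ : Measure α} [IsFiniteMeasure μ]
    {F : α → ι → κ → ℝ} (h : ∀ i k, HasMoments (fun x => F x i k) μ) (s : Finset ι) :
    HasMoments (fun x => _root_.gramDet (F x) s) μ :=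
  HasMoments.det fun i j => HasMoments.dotProduct (h i) (h j)

theorem gramDet_update_insert_eq_det_fromBlocks (R : ι → κ → ℝ) {s : Finset ι} {i : ι}
    (hi : i ∉ s) (v : κ → ℝ) :
    gramDet (Function.update R i v) (insert i s) =
      (fromBlocks (of fun i j : s => R i ⬝ᵥ R j) (of fun (i : s) (_ : Unit) => R i ⬝ᵥ v)
        (of fun (_ : Unit) (j : s) => v ⬝ᵥ R j) (of fun _ _ : Unit => v ⬝ᵥ v)).det := by
  have hne (j : s) : (j : ι) ≠ i := fun h => hi (h ▸ j.2)
  let e : s ⊕ Unit ≃ {j // j ∈ insert i s} :=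
    (Equiv.optionEquivSumPUnit s).symm.trans (Finset.subtypeInsertEquivOption hi).symm
  have e1 (j : s) : ((e (Sum.inl j) : {j // j ∈ insert i s}) : ι) = j := rfl
  have e2 (j : Unit) : ((e (Sum.inr j) : {j // j ∈ insert i s}) : ι) = i := rfl
  rw [gramDet, ← det_submatrix_equiv_self e]
  congr 1
  ext (a | a) (b | b) <;> simp [e1, e2, hne]

/-- The squared volume is that of the base times the squared height, so `A` is `gramDet R s` times
the orthogonal projection off the span of the rows in `s`. Trace and square of `A` are all that the
first two Gaussian moments need. -/
theorem gramDet_update_insert [DecidableEq κ] (R : ι → κ → ℝ) {s : Finset ι} {i : ι}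
    (hi : i ∉ s) :
    ∃ A : Matrix κ κ ℝ, A.IsSymm ∧ A.trace = (Fintype.card κ - s.card) * gramDet R s ∧
      A * A = gramDet R s • A ∧
      ∀ v, gramDet (Function.update R i v) (insert i s) = v ⬝ᵥ A *ᵥ v := by
  set B : Matrix s κ ℝ := of fun i => R i with hB
  set W : Matrix s s ℝ := B * Bᵀ with hW
  have hWR : (of fun i j : s => R i ⬝ᵥ R j) = W := by
    ext a b; simp [hW, hB, mul_apply, dotProduct]
  have hg : gramDet R s = W.det := by rw [gramDet, hWR]
  have hWs : Wᵀ = W := by simp [hW]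
  have c1 (v : κ → ℝ) : (of fun (i : s) (_ : Unit) => R i ⬝ᵥ v) = replicateCol Unit (B *ᵥ v) := by
    ext a b; simp [hB, mulVec]
  have c2 (v : κ → ℝ) : (of fun (_ : Unit) (i : s) => v ⬝ᵥ R i) = replicateRow Unit (B *ᵥ v) := by
    ext a b; simp [hB, mulVec, dotProduct_comm]
  simp only [gramDet_update_insert_eq_det_fromBlocks R hi, hWR, c1, c2, hg]
  -- Dependent rows: if `W x = 0`, then `‖Bᵀ x‖² = xᵀ W x = 0`, so `(x, 0)` is in the kernel of the
  -- bordered matrix for every `v`, and `A = 0` works.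
  by_cases hd : W.det = 0
  · refine ⟨0, by simp [IsSymm], by simp [hd], by simp, fun v => ?_⟩
    obtain ⟨x, hx, hWx⟩ := exists_mulVec_eq_zero_iff.2 hd
    have hBx : Bᵀ *ᵥ x = 0 := by
      apply dotProduct_self_eq_zero.1
      rw [dotProduct_mulVec, vecMul_transpose, dotProduct_comm, mulVec_mulVec, ← hW, hWx]
      simp
    simp only [zero_mulVec, dotProduct_zero]
    refine exists_mulVec_eq_zero_iff.1 ⟨Sum.elim x 0, ?_, ?_⟩
    · intro h
      exact hx (by ext a; simpa using congrFun h (Sum.inl a))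
    · rw [fromBlocks_mulVec]
      ext (a | a)
      · simp [hWx]
      · have : (B *ᵥ v) ⬝ᵥ x = 0 := by
          rw [dotProduct_comm, dotProduct_mulVec, ← mulVec_transpose, hBx, zero_dotProduct]
        simpa [mulVec, dotProduct] using this
  · have hu : IsUnit W.det := isUnit_iff_ne_zero.2 hd
    have : Invertible W := invertibleOfIsUnitDet W hu
    -- `Q` projects onto the row span of `B`; the Schur complement of the bordered matrix is `vᵀ (1
    -- - Q) v`.
    set Q : Matrix κ κ ℝ := Bᵀ * W⁻¹ * B with hQ
    have hQs : Qᵀ = Q := by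
      rw [hQ, transpose_mul, transpose_mul, transpose_transpose, transpose_nonsing_inv, hWs,
        Matrix.mul_assoc]
    have hQQ : Q * Q = Q := by
      calc Q * Q = Bᵀ * (W⁻¹ * (B * Bᵀ) * W⁻¹) * B := by simp only [hQ, Matrix.mul_assoc]
        _ = Q := by rw [← hW, nonsing_inv_mul _ hu, Matrix.one_mul]
    have hQt : Q.trace = s.card := by
      rw [hQ, trace_mul_comm, ← Matrix.mul_assoc, ← hW, mul_nonsing_inv _ hu, trace_one]
      simp
    refine ⟨W.det • (1 - Q), ?_, ?_, ?_, fun v => ?_⟩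
    · rw [IsSymm, transpose_smul, transpose_sub, transpose_one, hQs]
    · rw [trace_smul, trace_sub, trace_one, hQt, smul_eq_mul, mul_comm]
    · rw [smul_mul_smul_comm, smul_smul]
      congr 1
      rw [Matrix.sub_mul, Matrix.mul_sub, Matrix.mul_sub, hQQ]
      simp
    · rw [det_fromBlocks₁₁, det_unique (n := Unit), invOf_eq_nonsing_inv, smul_mulVec, dotProduct_smul,
        sub_mulVec, dotProduct_sub, one_mulVec, smul_eq_mul]
      congr 1
      simp only [Matrix.sub_apply, of_apply]
      congr 1
      rw [hQ, ← mulVec_mulVec, ← mulVec_mulVec, dotProduct_mulVec, vecMul_transpose,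
        dotProduct_mulVec]
      simp [mul_apply, dotProduct, vecMul]

theorem integral_gramDet_update_add [DecidableEq κ] (R : ι → κ → ℝ) {s : Finset ι} {i : ι}
    (hi : i ∉ s) (a : κ → ℝ) :
    ∫ v, gramDet (Function.update R i (a + v)) (insert i s) ∂stdNormalVec κ =
      gramDet (Function.update R i a) (insert i s) +
        (Fintype.card κ - s.card) * gramDet R s := by
  obtain ⟨A, -, ht, -, hA⟩ := gramDet_update_insert R hi
  simp only [hA]
  rw [integral_add_quadraticForm_stdNormalVec, ht]

theorem integral_gramDet_update [DecidableEq κ] (R : ι → κ → ℝ) {s : Finset ι} {i : ι}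
    (hi : i ∉ s) :
    ∫ v, gramDet (Function.update R i v) (insert i s) ∂stdNormalVec κ =
        (Fintype.card κ - s.card) * gramDet R s := by
  obtain ⟨A, -, ht, -, hA⟩ := gramDet_update_insert R hi
  have := integral_add_quadraticForm_stdNormalVec A 0
  simp only [zero_add, zero_dotProduct] at this
  simp only [hA, this, ht]

theorem integral_gramDet_update_sq [DecidableEq κ] (R : ι → κ → ℝ) {s : Finset ι} {i : ι}
    (hi : i ∉ s) :
    ∫ v, gramDet (Function.update R i v) (insert i s) ^ 2 ∂stdNormalVec κ =
        (Fintype.card κ - s.card) * (Fintype.card κ + 2 - s.card) * gramDet R s ^ 2 := by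
  obtain ⟨A, hs, ht, h2, hA⟩ := gramDet_update_insert R hi
  simp only [hA]
  rw [integral_quadraticForm_sq_stdNormalVec hs, h2, trace_smul, ht, smul_eq_mul]
  ring

end

/-! ### Moments of Gram determinants, by integrating out one row at a time -/

theorem ite_insert_add_update {ι κ : Type*} [DecidableEq ι] (A V : ι → κ → ℝ) (t : Finset ι) {i : ι} (hi : i ∉ t)
    (v : κ → ℝ) :
    (fun j => if j ∈ insert i t then A j + Function.update V i v j else A j) =
      Function.update (fun j => if j ∈ t then A j + V j else A j) i (A i + v) := by
  ext j : 1
  by_cases hj : j = i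
  · subst hj; simp
  · simp [hj]

theorem Nat.cast_descFactorial_succ_eq (n k : ℕ) :
    ((n.descFactorial (k + 1) : ℕ) : ℝ) = (n - k) * (n.descFactorial k : ℕ) := by
  rw [Nat.descFactorial_succ]
  -- Real and truncated subtraction disagree only for `k > n`, where both falling factorials vanish.
  rcases le_or_gt k n with h | h
  · push_cast [h]; ring
  · rw [Nat.descFactorial_of_lt h]; simp

section

variable {ι κ : Type*} [Fintype ι] [DecidableEq ι] [Fintype κ]

theorem hasMoments_gramDet_stdNormalMat (s : Finset ι) :
    HasMoments (fun U : ι → κ → ℝ => gramDet U s) (stdNormalMat ι κ) :=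
  HasMoments.gramDet (fun i k => hasMoments_stdNormalMat i k) s

theorem integral_stdNormalMat_update (i : ι) {f : (ι → κ → ℝ) → ℝ}
    (hf : HasMoments f (stdNormalMat ι κ)) :
    ∫ U, f U ∂stdNormalMat ι κ =
      ∫ U, ∫ v, f (Function.update U i v) ∂stdNormalVec κ ∂stdNormalMat ι κ :=
  integral_pi_eq_integral_update _ i hf.integrable

theorem hasMoments_ite_add (A : ι → κ → ℝ) (t : Finset ι) (i : ι) (k : κ) :
    HasMoments (fun V : ι → κ → ℝ => (if i ∈ t then A i + V i else A i) k)
      (stdNormalMat ι κ) := by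
  split_ifs
  · exact (HasMoments.const _).add (hasMoments_stdNormalMat i k)
  · exact HasMoments.const _

variable [DecidableEq κ]

theorem integral_gramDet_sq_stdNormalMat (K : Finset ι) :
    ∫ U, gramDet U K ^ 2 ∂stdNormalMat ι κ =
      (Fintype.card κ).descFactorial K.card * (Fintype.card κ + 2).descFactorial K.card := by
  induction K using Finset.induction_on with
  | empty => simp [gramDet_empty]
  | insert i s hi ih =>
    rw [integral_stdNormalMat_update i ((hasMoments_gramDet_stdNormalMat _).pow 2)]
    simp only [integral_gramDet_update_sq _ hi]
    rw [integral_const_mul, ih, Finset.card_insert_of_notMem hi, Nat.cast_descFactorial_succ_eq,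
      Nat.cast_descFactorial_succ_eq]
    push_cast
    ring

/-- A row outside `K` enters the first factor only and contributes a first moment. Once these rows
are integrated out the two factors coincide, and the second moment of `gramDet U K` remains. -/
theorem integral_gramDet_mul_gramDet_stdNormalMat {K s : Finset ι} (h : K ⊆ s) :
    ∫ U, gramDet U s * gramDet U K ∂stdNormalMat ι κ =
      (Fintype.card κ).descFactorial s.card * (Fintype.card κ + 2).descFactorial K.card := by
  obtain ⟨t, ht, rfl⟩ : ∃ t, Disjoint t K ∧ t ∪ K = s :=
    ⟨s \ K, Finset.sdiff_disjoint, Finset.sdiff_union_of_subset h⟩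
  clear h
  induction t using Finset.induction_on with
  | empty => simpa [pow_two] using integral_gramDet_sq_stdNormalMat K
  | insert i t hi ih =>
    rw [Finset.disjoint_insert_left] at ht
    have hi' : i ∉ t ∪ K := by simp [hi, ht.1]
    rw [integral_stdNormalMat_update i ((hasMoments_gramDet_stdNormalMat _).mul
      (hasMoments_gramDet_stdNormalMat _)), Finset.insert_union]
    simp only [gramDet_update_of_notMem _ ht.1, integral_mul_const,
      integral_gramDet_update _ hi', mul_assoc]
    rw [integral_const_mul, ih ht.2, Finset.card_insert_of_notMem hi',
      Nat.cast_descFactorial_succ_eq]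
    ring

theorem integral_gramDet_stdNormalMat (s : Finset ι) :
    ∫ U, gramDet U s ∂stdNormalMat ι κ = (Fintype.card κ).descFactorial s.card := by
  simpa [gramDet_empty] using
    integral_gramDet_mul_gramDet_stdNormalMat (κ := κ) (Finset.empty_subset s)

/-- Averaging the noise in row `i` either keeps `A i` or deletes the row at the price `n - (|s| -
1)`, `n` being the number of columns. Each deletion shrinks `s`, so the price rises by one; `L` is
the set of deleted rows. -/
theorem integral_gramDet_ite_add (A : ι → κ → ℝ) (t s : Finset ι) (h : t ⊆ s) :
    ∫ V, gramDet (fun i => if i ∈ t then A i + V i else A i) s ∂stdNormalMat ι κ =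
      ∑ L ∈ t.powerset, (∏ j ∈ Finset.range L.card, ((Fintype.card κ : ℝ) - s.card + 1 + j)) *
        gramDet A (s \ L) := by
  induction t using Finset.induction_on generalizing s with
  | empty => simp
  | insert i t hi ih =>
    rw [Finset.insert_subset_iff] at h
    have hit : t ⊆ s.erase i := Finset.subset_erase.2 ⟨h.2, hi⟩
    have hm (s : Finset ι) := HasMoments.gramDet (hasMoments_ite_add A t) s
    have hcard : (((s.erase i).card : ℕ) : ℝ) = s.card - 1 := by
      rw [Finset.card_erase_of_mem h.1, Nat.cast_pred (Finset.card_pos.2 ⟨i, h.1⟩)]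
    rw [integral_stdNormalMat_update i (HasMoments.gramDet (hasMoments_ite_add A _) s)]
    have key (V : ι → κ → ℝ) : ∫ v, gramDet (fun j => if j ∈ insert i t then
        A j + Function.update V i v j else A j) s ∂stdNormalVec κ =
        gramDet (fun j => if j ∈ t then A j + V j else A j) s +
          (Fintype.card κ - s.card + 1) *
            gramDet (fun j => if j ∈ t then A j + V j else A j) (s.erase i) := by
      have := integral_gramDet_update_add (fun j => if j ∈ t then A j + V j else A j)
        (Finset.notMem_erase i s) (A i)
      rw [Finset.insert_erase h.1] at this
      simp only [ite_insert_add_update A V t hi]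
      rw [this, hcard]
      congr 1
      · refine gramDet_congr fun j _ => ?_
        by_cases hj : j = i
        · subst hj; simp [hi]
        · simp [hj]
      · ring
    simp only [key]
    rw [integral_add (hm _).integrable ((hm _).integrable.const_mul _), integral_const_mul,
      ih s h.2, ih _ hit, Finset.sum_powerset_insert hi, Finset.mul_sum]
    congr 1
    refine Finset.sum_congr rfl fun L hL => ?_
    have hiL : i ∉ L := fun hL' => hi (Finset.mem_powerset.1 hL hL')
    have hset : s.erase i \ L = s \ insert i L := by
      ext j; simp only [Finset.mem_sdiff, Finset.mem_erase, Finset.mem_insert]; tauto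
    rw [Finset.card_insert_of_notMem hiL, Finset.prod_range_succ', hset, hcard]
    have : ∀ j : ℕ, (Fintype.card κ : ℝ) - (s.card - 1) + 1 + j =
        Fintype.card κ - s.card + 1 + (j + 1 : ℕ) := by intro j; push_cast; ring
    simp only [this]
    push_cast
    ring

/-- The determinant is affine in each row and the noise is centred. -/
theorem integral_det_ite_add (A : ι → ι → ℝ) (t : Finset ι) :
    ∫ V, (of fun i => if i ∈ t then A i + V i else A i).det ∂stdNormalMat ι ι = (of A).det := by
  have hm (t : Finset ι) : HasMoments (fun V : ι → ι → ℝ =>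
      (of fun i => if i ∈ t then A i + V i else A i).det) (stdNormalMat ι ι) :=
    HasMoments.det (hasMoments_ite_add A t)
  induction t using Finset.induction_on with
  | empty => simp
  | insert i t hi ih =>
    rw [← ih, integral_stdNormalMat_update i (hm _)]
    congr 1
    ext V
    simp only [ite_insert_add_update A V t hi]
    set M : Matrix ι ι ℝ := of fun j => if j ∈ t then A j + V j else A j with hM
    have h1 (v : ι → ℝ) : (of (Function.update (fun j => if j ∈ t then A j + V j else A j) i
        (A i + v))).det = M.det + ∑ k, v k * Mᵀ.adjugate i k := by
      have e1 : M.updateRow i (A i) = M := by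
        have : A i = M i := by ext; simp [hM, hi]
        rw [this, updateRow_eq_self]
      change (M.updateRow i (A i + v)).det = _
      rw [det_updateRow_add, e1, ← cramer_transpose_apply M v, cramer_eq_adjugate_mulVec]
      simp only [mulVec, dotProduct, mul_comm]
    simp only [h1]
    have hk (k : ι) : Integrable (fun v : ι → ℝ => v k * Mᵀ.adjugate i k)
        (stdNormalVec ι) := (hasMoments_stdNormalVec k).integrable.mul_const _
    rw [integral_add (integrable_const _) (integrable_finsetSum _ fun k _ => hk k),
      integral_finsetSum _ fun k _ => hk k]
    simp [integral_mul_const, integral_stdNormalVec_apply]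

end

/-! ### Sums of principal minors and moments conditional on `U` -/

/-- The sum of the principal `k × k` minors of `M`. -/
noncomputable def minorSum {ι : Type*} [Fintype ι] [DecidableEq ι] (k : ℕ) (M : Matrix ι ι ℝ) : ℝ :=
  ∑ s ∈ Finset.univ.powersetCard k, (M.submatrix (Subtype.val : s → ι) (Subtype.val : s → ι)).det

theorem gramDet_eq_det_submatrix {ι κ : Type*} [DecidableEq ι] [Fintype κ] (R : ι → κ → ℝ) (s : Finset ι) :
    gramDet R s =
      ((of R * (of R)ᵀ).submatrix (Subtype.val : s → ι) (Subtype.val : s → ι)).det := by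
  rw [gramDet]
  congr 1

theorem posSemidef_self_mul_transpose {ι κ : Type*} [Fintype ι] [Fintype κ] (U : Matrix ι κ ℝ) : (U * Uᵀ).PosSemidef := by
  simpa [conjTranspose_eq_transpose_of_trivial] using posSemidef_self_mul_conjTranspose U

theorem of_mul_transpose_eq_of_mulVec {ι κ : Type*} [Fintype κ] (M : Matrix ι κ ℝ)
    (V : ι → κ → ℝ) : of V * Mᵀ = of fun i => M *ᵥ V i := by
  ext i j
  simp [mul_apply, mulVec, dotProduct, mul_comm]

theorem integral_mul_transpose_stdNormalMat_congr {ι κ κ' : Type*} [Fintype ι] [Fintype κ] [Fintype κ']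
    {M : Matrix ι κ ℝ} {M' : Matrix ι κ' ℝ} (h : M * Mᵀ = M' * M'ᵀ)
    {f : Matrix ι ι ℝ → ℝ} (hf : Continuous f) :
    ∫ V, f (of V * Mᵀ) ∂stdNormalMat ι κ = ∫ V, f (of V * M'ᵀ) ∂stdNormalMat ι κ' := by
  have key : (stdNormalMat ι κ).map (fun V i => M *ᵥ V i) =
      (stdNormalMat ι κ').map (fun V i => M' *ᵥ V i) := by
    have h1 : IsProbabilityMeasure ((stdNormalVec κ).map (M *ᵥ ·)) :=
      Measure.isProbabilityMeasure_map (by fun_prop)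
    have h2 : IsProbabilityMeasure ((stdNormalVec κ').map (M' *ᵥ ·)) :=
      Measure.isProbabilityMeasure_map (by fun_prop)
    rw [stdNormalMat, stdNormalMat,
      Measure.pi_map_pi (f := fun _ : ι => (M *ᵥ · : (κ → ℝ) → ι → ℝ)) fun _ => by fun_prop,
      Measure.pi_map_pi (f := fun _ : ι => (M' *ᵥ · : (κ' → ℝ) → ι → ℝ)) fun _ => by fun_prop,
      map_mulVec_stdNormalVec_congr h]
  have hf' : Continuous fun H : ι → ι → ℝ => f (of H) := hf
  simp only [of_mul_transpose_eq_of_mulVec]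
  have hm : AEMeasurable (fun (V : ι → κ → ℝ) i => M *ᵥ V i) (stdNormalMat ι κ) :=
    (Continuous.measurable (by fun_prop)).aemeasurable
  have hm' : AEMeasurable (fun (V : ι → κ' → ℝ) i => M' *ᵥ V i) (stdNormalMat ι κ') :=
    (Continuous.measurable (by fun_prop)).aemeasurable
  rw [← integral_map (f := fun H : ι → ι → ℝ => f (of H)) hm hf'.aestronglyMeasurable, key,
    integral_map hm' hf'.aestronglyMeasurable]

section

variable {ι κ : Type*} [Fintype ι] [DecidableEq ι] [Fintype κ]

/-- These sums are the coefficients of `det (1 + X A B)`, which equals `det (1 + X B A)`. -/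
theorem minorSum_mul_comm (k : ℕ) (A B : Matrix ι ι ℝ) :
    minorSum k (A * B) = minorSum k (B * A) := by
  simp only [minorSum, ← coeff_det_one_add_X_smul_eq_sum_minors, Matrix.map_mul]
  rw [← Matrix.smul_mul, det_one_add_mul_comm, Matrix.mul_smul]

theorem minorSum_neg (k : ℕ) (M : Matrix ι ι ℝ) :
    minorSum k (-M) = (-1) ^ k * minorSum k M := by
  simp only [minorSum, Finset.mul_sum]
  refine Finset.sum_congr rfl fun s hs => ?_
  rw [submatrix_neg, Pi.neg_apply, Pi.neg_apply, det_neg, Fintype.card_coe,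
    (Finset.mem_powersetCard.1 hs).2]

theorem minorSum_card (M : Matrix ι ι ℝ) : minorSum (Fintype.card ι) M = M.det := by
  rw [minorSum, ← Finset.card_univ, Finset.powersetCard_self, Finset.sum_singleton]
  exact det_submatrix_equiv_self (Equiv.subtypeUnivEquiv Finset.mem_univ) M

theorem det_submatrix_mul_diagonal (W : Matrix ι ι ℝ) (l : ι → ℝ) (s : Finset ι) :
    ((W * diagonal l).submatrix (Subtype.val : s → ι) (Subtype.val : s → ι)).det =
      (∏ i ∈ s, l i) * (W.submatrix (Subtype.val : s → ι) (Subtype.val : s → ι)).det := by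
  have : (W * diagonal l).submatrix (Subtype.val : s → ι) (Subtype.val : s → ι) =
      W.submatrix Subtype.val Subtype.val * diagonal fun i : s => l i := by
    ext i j
    simp [mul_diagonal]
  rw [this, det_mul, det_diagonal, mul_comm, Finset.prod_coe_sort]

theorem minorSum_mul_diagonal (k : ℕ) (W : Matrix ι ι ℝ) (l : ι → ℝ) :
    minorSum k (W * diagonal l) = ∑ s ∈ Finset.univ.powersetCard k, (∏ i ∈ s, l i) *
      (W.submatrix (Subtype.val : s → ι) (Subtype.val : s → ι)).det :=
  Finset.sum_congr rfl fun s _ => det_submatrix_mul_diagonal W l s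

theorem minorSum_diagonal (k : ℕ) (l : ι → ℝ) :
    minorSum k (diagonal l) = ∑ s ∈ Finset.univ.powersetCard k, ∏ i ∈ s, l i := by
  rw [← Matrix.one_mul (diagonal l), minorSum_mul_diagonal]
  refine Finset.sum_congr rfl fun s _ => ?_
  rw [submatrix_one _ Subtype.val_injective, det_one, mul_one]

theorem gramDet_univ (R : ι → κ → ℝ) : gramDet R Finset.univ = (of R * (of R)ᵀ).det := by
  rw [gramDet_eq_det_submatrix]
  exact det_submatrix_equiv_self (Equiv.subtypeUnivEquiv Finset.mem_univ) _

theorem integral_det_add_sq_stdNormalMat (A : Matrix ι ι ℝ) :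
    ∫ V, (A + of V).det ^ 2 ∂stdNormalMat ι ι = ∑ k ∈ Finset.range (Fintype.card ι + 1),
      ((Fintype.card ι - k)! : ℝ) * minorSum k (A * Aᵀ) := by
  have h := integral_gramDet_ite_add (κ := ι) (of.symm A) Finset.univ Finset.univ subset_rfl
  have hl (V : ι → ι → ℝ) : gramDet (fun i => if i ∈ Finset.univ then of.symm A i + V i else of.symm A i)
      Finset.univ = (A + of V).det ^ 2 := by
    rw [gramDet_univ, det_mul, det_transpose, pow_two]
    simp only [Finset.mem_univ, if_true]
    rfl
  have hf (k : ℕ) : ∏ j ∈ Finset.range k,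
      ((Fintype.card ι : ℝ) - (Finset.univ : Finset ι).card + 1 + j) = k ! := by
    rw [← Finset.prod_range_add_one_eq_factorial, Finset.card_univ]
    push_cast
    exact Finset.prod_congr rfl fun j _ => by ring
  simp only [hl, hf] at h
  -- Pass from the set of deleted rows to its complement, the set of kept rows. For a square array
  -- the deletion prices are `1, 2, 3, …`, hence the factorial.
  rw [h, Finset.powerset_univ,
    ← Equiv.sum_comp (Function.Involutive.toPerm _ (compl_involutive (α := Finset ι))), ← Finset.powerset_univ,
    Finset.sum_powerset, Finset.card_univ]
  refine Finset.sum_congr rfl fun k _ => ?_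
  rw [minorSum, Finset.mul_sum]
  refine Finset.sum_congr rfl fun s hs => ?_
  have e : Finset.univ \ Function.Involutive.toPerm _ compl_involutive s = s := by
    rw [← Finset.compl_eq_univ_sdiff]; exact compl_compl s
  rw [e, gramDet_eq_det_submatrix, Equiv.apply_symm_apply]
  congr 2
  rw [← (Finset.mem_powersetCard.1 hs).2]
  exact congrArg _ (Finset.card_compl s)

theorem integral_det_add_stdNormalMat (A : Matrix ι ι ℝ) :
    ∫ V, (A + of V).det ∂stdNormalMat ι ι = A.det := by
  have h := integral_det_ite_add A Finset.univ
  simp only [Finset.mem_univ, if_true] at h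
  exact h

open scoped MatrixOrder in
theorem exists_mul_transpose_eq_of_posSemidef {W : Matrix ι ι ℝ} (hW : W.PosSemidef) :
    ∃ T : Matrix ι ι ℝ, T * Tᵀ = W := by
  refine ⟨CFC.sqrt W, ?_⟩
  have := (CFC.sqrt_nonneg W).isSelfAdjoint
  have ht : (CFC.sqrt W)ᵀ = CFC.sqrt W := by
    simpa [IsSelfAdjoint, star_eq_conjTranspose, conjTranspose_eq_transpose_of_trivial] using this
  rw [ht, CFC.sqrt_mul_sqrt_self _ hW.nonneg]

/-- With `T Tᵀ = U Uᵀ` and `T` square, `V Uᵀ` may be replaced by `V' Tᵀ`; then `(C T + V') Tᵀ`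
splits into square factors. No rank assumption on `U` is needed. -/
theorem integral_det_mul_add_mul_transpose_sq (C : Matrix ι ι ℝ) (U : Matrix ι κ ℝ) :
    ∫ V, ((C * U + of V) * Uᵀ).det ^ 2 ∂stdNormalMat ι κ = (U * Uᵀ).det *
      ∑ k ∈ Finset.range (Fintype.card ι + 1),
        ((Fintype.card ι - k)! : ℝ) * minorSum k (U * Uᵀ * (Cᵀ * C)) := by
  obtain ⟨T, hT⟩ := exists_mul_transpose_eq_of_posSemidef (posSemidef_self_mul_transpose U)
  have h := integral_mul_transpose_stdNormalMat_congr hT.symm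
    (f := fun H => (C * (U * Uᵀ) + H).det ^ 2) (by fun_prop)
  have e1 (V : ι → κ → ℝ) : (C * U + of V) * Uᵀ = C * (U * Uᵀ) + of V * Uᵀ := by
    rw [Matrix.add_mul, Matrix.mul_assoc]
  have e2 (V : ι → ι → ℝ) : C * (U * Uᵀ) + of V * Tᵀ = (C * T + of V) * Tᵀ := by
    rw [Matrix.add_mul, Matrix.mul_assoc, hT]
  simp only [e1, h, e2, det_mul, mul_pow, integral_mul_const]
  rw [← hT, det_mul, det_transpose, mul_comm, ← pow_two,
    integral_det_add_sq_stdNormalMat]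
  congr 1
  refine Finset.sum_congr rfl fun k _ => ?_
  congr 1
  rw [transpose_mul, Matrix.mul_assoc, ← Matrix.mul_assoc T, minorSum_mul_comm, Matrix.mul_assoc]

theorem integral_det_mul_add_mul_transpose (C : Matrix ι ι ℝ) (U : Matrix ι κ ℝ) :
    ∫ V, ((C * U + of V) * Uᵀ).det ∂stdNormalMat ι κ = C.det * (U * Uᵀ).det := by
  obtain ⟨T, hT⟩ := exists_mul_transpose_eq_of_posSemidef (posSemidef_self_mul_transpose U)
  have h := integral_mul_transpose_stdNormalMat_congr hT.symm
    (f := fun H => (C * (U * Uᵀ) + H).det) (by fun_prop)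
  have e1 (V : ι → κ → ℝ) : (C * U + of V) * Uᵀ = C * (U * Uᵀ) + of V * Uᵀ := by
    rw [Matrix.add_mul, Matrix.mul_assoc]
  have e2 (V : ι → ι → ℝ) : C * (U * Uᵀ) + of V * Tᵀ = (C * T + of V) * Tᵀ := by
    rw [Matrix.add_mul, Matrix.mul_assoc, hT]
  simp only [e1, h, e2]
  simp only [det_mul, integral_mul_const, integral_det_add_stdNormalMat]
  rw [← hT, det_mul]
  ring

theorem hasMoments_det_mul_add_mul_transpose (C : Matrix ι ι ℝ) :
    HasMoments (fun p : (ι → κ → ℝ) × (ι → κ → ℝ) =>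
      ((C * of p.1 + of p.2) * (of p.1)ᵀ).det)
      ((stdNormalMat ι κ).prod (stdNormalMat ι κ)) := by
  have h1 (i : ι) (k : κ) : HasMoments (fun p : (ι → κ → ℝ) × (ι → κ → ℝ) => p.1 i k)
      ((stdNormalMat ι κ).prod (stdNormalMat ι κ)) :=
    (hasMoments_stdNormalMat i k).comp_measurePreserving measurePreserving_fst
  have h2 (i : ι) (k : κ) : HasMoments (fun p : (ι → κ → ℝ) × (ι → κ → ℝ) => p.2 i k)
      ((stdNormalMat ι κ).prod (stdNormalMat ι κ)) :=
    (hasMoments_stdNormalMat i k).comp_measurePreserving measurePreserving_snd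
  refine HasMoments.det fun i j => HasMoments.sum _ fun k => HasMoments.mul ?_ (h1 j k)
  exact (HasMoments.sum _ fun l => (HasMoments.const _).mul (h1 l k)).add (h2 i k)

theorem integral_prod_det_mul_add_mul_transpose (C : Matrix ι ι ℝ) :
    ∫ p, ((C * of p.1 + of p.2) * (of p.1)ᵀ).det ∂(stdNormalMat ι κ).prod (stdNormalMat ι κ) =
      (Fintype.card κ).descFactorial (Fintype.card ι) * C.det := by
  classical
  rw [integral_prod _ (hasMoments_det_mul_add_mul_transpose C).integrable]
  simp only [integral_det_mul_add_mul_transpose, ← gramDet_univ, integral_const_mul,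
    integral_gramDet_stdNormalMat, Finset.card_univ]
  ring

/-- Diagonality of `Cᵀ C` makes each principal minor of `U Uᵀ Cᵀ C` a constant times a Gram
determinant of rows of `U`, so no mixed minors have to be averaged. -/
theorem integral_prod_det_mul_add_mul_transpose_sq {C : Matrix ι ι ℝ} {l : ι → ℝ}
    (hC : Cᵀ * C = diagonal l) :
    ∫ p, ((C * of p.1 + of p.2) * (of p.1)ᵀ).det ^ 2
        ∂(stdNormalMat ι κ).prod (stdNormalMat ι κ) =
      (Fintype.card κ).descFactorial (Fintype.card ι) *
        ∑ k ∈ Finset.range (Fintype.card ι + 1), ((Fintype.card ι - k)! : ℝ) *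
          (Fintype.card κ + 2).descFactorial k * minorSum k (Cᵀ * C) := by
  classical
  have hm (s : Finset ι) : Integrable (fun U : ι → κ → ℝ =>
      gramDet U Finset.univ * gramDet U s) (stdNormalMat ι κ) :=
    ((hasMoments_gramDet_stdNormalMat _).mul (hasMoments_gramDet_stdNormalMat _)).integrable
  rw [integral_prod _ ((hasMoments_det_mul_add_mul_transpose C).pow 2).integrable]
  simp only [integral_det_mul_add_mul_transpose_sq, hC, minorSum_mul_diagonal, minorSum_diagonal,
    ← gramDet_univ, ← gramDet_eq_det_submatrix, Finset.mul_sum]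
  have e (U : ι → κ → ℝ) (k : ℕ) (s : Finset ι) :
      gramDet U Finset.univ * (((Fintype.card ι - k)! : ℝ) * ((∏ i ∈ s, l i) * gramDet U s)) =
      ((Fintype.card ι - k)! : ℝ) * (∏ i ∈ s, l i) * (gramDet U Finset.univ * gramDet U s) := by
    ring
  simp only [e]
  rw [integral_finsetSum _ fun k _ => integrable_finsetSum _ fun s _ => (hm s).const_mul _]
  refine Finset.sum_congr rfl fun k _ => ?_
  rw [integral_finsetSum _ fun s _ => (hm s).const_mul _]
  refine Finset.sum_congr rfl fun s hs => ?_
  rw [integral_const_mul, integral_gramDet_mul_gramDet_stdNormalMat (Finset.subset_univ s),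
    (Finset.mem_powersetCard.1 hs).2, Finset.card_univ]
  ring

end

/-! ### Compounds and the block factorization of the covariance -/

theorem trace_compound_eq_minorSum {m : ℕ} (k : ℕ) (A : Matrix (Fin m) (Fin m) ℝ) :
    (compound k A).trace = minorSum k A := by
  have h (K : {K : Finset (Fin m) // K.card = k}) : compound k A K K =
      (A.submatrix (Subtype.val : K.1 → Fin m) (Subtype.val : K.1 → Fin m)).det := by
    rw [compound, of_apply, ← det_submatrix_equiv_self (K.1.orderIsoOfFin K.2).toEquiv]
    rfl
  simp only [trace, diag_apply, h]
  rw [minorSum]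
  symm
  apply Finset.sum_subtype (f := fun s : Finset (Fin m) =>
    (A.submatrix (Subtype.val : s → Fin m) (Subtype.val : s → Fin m)).det)
  simp [Finset.mem_powersetCard]

section

variable {ι : Type*} [Fintype ι] [DecidableEq ι]

/-- A factor of `B` is free up to an orthogonal matrix on the right, which is spent on diagonalizing
the second form. -/
theorem exists_factor_diagonalizing {B N : Matrix ι ι ℝ} (hB : B.PosSemidef) (hN : N.IsSymm) :
    ∃ (P : Matrix ι ι ℝ) (l : ι → ℝ), P * Pᵀ = B ∧ Pᵀ * N * P = diagonal l := by
  obtain ⟨T, hT⟩ := exists_mul_transpose_eq_of_posSemidef hB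
  have hs : (Tᵀ * N * T).IsSymm := by
    rw [IsSymm, transpose_mul, transpose_mul, transpose_transpose, hN, Matrix.mul_assoc]
  obtain ⟨O, l, hO, hl⟩ := exists_orthogonal_diagonalization hs
  refine ⟨T * O, l, ?_, ?_⟩
  · rw [transpose_mul, Matrix.mul_assoc, ← Matrix.mul_assoc O, hO, Matrix.one_mul, hT]
  · rw [← hl, transpose_mul]
    simp only [Matrix.mul_assoc]

theorem exists_block_factorization {S₁₁ S₁₂ S₂₂ : Matrix ι ι ℝ}
    (h : (fromBlocks S₁₁ S₁₂ S₁₂ᵀ S₂₂).PosDef) :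
    ∃ (P R C : Matrix ι ι ℝ) (l : ι → ℝ),
      fromBlocks S₁₁ S₁₂ S₁₂ᵀ S₂₂ = fromBlocks P 0 (R * C) R * (fromBlocks P 0 (R * C) R)ᵀ ∧
      Cᵀ * C = diagonal l ∧
      ∀ k, minorSum k (Cᵀ * C) =
        (-1) ^ k * minorSum k (S₁₂ᵀ * (fromBlocks S₁₁ S₁₂ S₁₂ᵀ S₂₂)⁻¹.toBlocks₁₂) := by
  have h1 : S₁₁.PosDef := by
    have := h.submatrix (e := (Sum.inl : ι → ι ⊕ ι)) Sum.inl_injective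
    exact this
  have u1 : IsUnit S₁₁.det := h1.det_pos.ne'.isUnit
  have : Invertible S₁₁ := invertibleOfIsUnitDet _ u1
  have t1 : S₁₁ᵀ = S₁₁ := by
    simpa [IsHermitian, conjTranspose_eq_transpose_of_trivial] using h1.isHermitian
  set D : Matrix ι ι ℝ := S₂₂ - S₁₂ᵀ * S₁₁⁻¹ * S₁₂ with hD
  have hDpos : D.PosSemidef := by
    have := (PosDef.fromBlocks₁₁ S₁₂ S₂₂ h1).1
      (by simpa [conjTranspose_eq_transpose_of_trivial] using h.posSemidef)
    simpa [conjTranspose_eq_transpose_of_trivial] using this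
  have hdet : (fromBlocks S₁₁ S₁₂ S₁₂ᵀ S₂₂).det = S₁₁.det * D.det := by
    rw [det_fromBlocks₁₁, invOf_eq_nonsing_inv]
  have uD : IsUnit D.det := by
    have := h.det_pos.ne'
    rw [hdet] at this
    exact (right_ne_zero_of_mul this).isUnit
  have : Invertible D := invertibleOfIsUnitDet _ uD
  have tD : Dᵀ = D := by
    simpa [IsHermitian, conjTranspose_eq_transpose_of_trivial] using hDpos.isHermitian
  obtain ⟨R, hR⟩ := exists_mul_transpose_eq_of_posSemidef hDpos
  -- With `D = R Rᵀ` the Schur complement and `C = R⁻¹ S₁₂ᵀ Pᵀ⁻¹`, the product `Cᵀ C` equals `Pᵀ N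
  -- P` for this `N`.
  obtain ⟨P, l, hP, hl⟩ := exists_factor_diagonalizing
    (N := S₁₁⁻¹ * S₁₂ * D⁻¹ * S₁₂ᵀ * S₁₁⁻¹) h1.posSemidef (by
      rw [IsSymm]
      simp only [transpose_mul, transpose_transpose, transpose_nonsing_inv, t1, tD,
        Matrix.mul_assoc])
  have uR : IsUnit R.det := by
    rw [← hR, det_mul] at uD; exact isUnit_of_mul_isUnit_left uD
  have uP : IsUnit P.det := by
    rw [← hP, det_mul] at u1; exact isUnit_of_mul_isUnit_left u1
  have uPt : IsUnit Pᵀ.det := by rwa [det_transpose]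
  have iP : Pᵀ⁻¹ * P⁻¹ = S₁₁⁻¹ := by rw [← hP, Matrix.mul_inv_rev]
  have iD : R⁻¹ᵀ * R⁻¹ = D⁻¹ := by rw [← hR, Matrix.mul_inv_rev, transpose_nonsing_inv]
  set C := R⁻¹ * S₁₂ᵀ * Pᵀ⁻¹ with hC
  have hRC : R * C = S₁₂ᵀ * Pᵀ⁻¹ := by
    rw [hC, Matrix.mul_assoc, ← Matrix.mul_assoc, mul_nonsing_inv _ uR, Matrix.one_mul]
  have hCC : Cᵀ * C = P⁻¹ * (S₁₂ * D⁻¹ * S₁₂ᵀ * Pᵀ⁻¹) := by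
    rw [hC, ← iD]
    simp only [transpose_mul, transpose_nonsing_inv, transpose_transpose, Matrix.mul_assoc]
  -- The minus sign in this block of the inverse is the source of the factor `(-1)^k`.
  have hinv : (fromBlocks S₁₁ S₁₂ S₁₂ᵀ S₂₂)⁻¹.toBlocks₁₂ = -(S₁₁⁻¹ * S₁₂ * D⁻¹) := by
    have : Invertible (S₂₂ - S₁₂ᵀ * ⅟S₁₁ * S₁₂) := by
      rw [invOf_eq_nonsing_inv]; assumption
    have : Invertible (fromBlocks S₁₁ S₁₂ S₁₂ᵀ S₂₂) := fromBlocks₁₁Invertible _ _ _ _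
    rw [← invOf_eq_nonsing_inv, invOf_fromBlocks₁₁_eq, toBlocks_fromBlocks₁₂]
    simp only [invOf_eq_nonsing_inv]
    rfl
  refine ⟨P, R, C, l, ?_, ?_, fun k => ?_⟩
  · rw [fromBlocks_transpose, fromBlocks_multiply, hRC]
    have e1 : S₁₂ᵀ * Pᵀ⁻¹ * Pᵀ = S₁₂ᵀ := by
      rw [Matrix.mul_assoc, nonsing_inv_mul _ uPt, Matrix.mul_one]
    have e2 : P * (S₁₂ᵀ * Pᵀ⁻¹)ᵀ = S₁₂ := by
      have := congrArg transpose e1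
      rwa [transpose_mul, transpose_transpose, transpose_transpose] at this
    have e3 : S₁₂ᵀ * Pᵀ⁻¹ * (S₁₂ᵀ * Pᵀ⁻¹)ᵀ = S₁₂ᵀ * S₁₁⁻¹ * S₁₂ := by
      rw [← iP]
      simp only [transpose_mul, transpose_nonsing_inv, transpose_transpose, Matrix.mul_assoc]
    simp only [transpose_zero, Matrix.mul_zero, Matrix.zero_mul, add_zero, e1, e2, e3, hP, hR, hD]
    rw [add_sub_cancel]
  · rw [hCC, ← hl, ← iP]
    calc _ = (P⁻¹ * S₁₂ * D⁻¹ * S₁₂ᵀ * Pᵀ⁻¹) := by simp only [Matrix.mul_assoc]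
      _ = (Pᵀ * Pᵀ⁻¹) * (P⁻¹ * S₁₂ * D⁻¹ * S₁₂ᵀ * Pᵀ⁻¹) * (P⁻¹ * P) := by
        rw [mul_nonsing_inv _ uPt, nonsing_inv_mul _ uP, Matrix.one_mul, Matrix.mul_one]
      _ = _ := by simp only [Matrix.mul_assoc]
  · rw [hCC, hinv, Matrix.mul_neg, minorSum_neg, ← mul_assoc ((-1 : ℝ) ^ k), ← mul_pow,
      minorSum_mul_comm]
    have : S₁₂ * D⁻¹ * S₁₂ᵀ * Pᵀ⁻¹ * P⁻¹ = (S₁₂ * D⁻¹) * (S₁₂ᵀ * S₁₁⁻¹) := by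
      rw [← iP]; simp only [Matrix.mul_assoc]
    rw [this, minorSum_mul_comm]
    simp [Matrix.mul_assoc]

end

/-! ### The law of the off-diagonal minor -/

theorem measurePreserving_sumElim_swap_stdNormalMat (ι ι' κ : Type*) [Fintype ι] [Fintype ι']
    [Fintype κ] :
    MeasurePreserving
      (fun (p : (ι → κ → ℝ) × (ι' → κ → ℝ)) (k : κ) (s : ι ⊕ ι') => Sum.elim p.1 p.2 s k)
      ((stdNormalMat ι κ).prod (stdNormalMat ι' κ)) (stdNormalMat κ (ι ⊕ ι')) := by
  have h1 := measurePreserving_sumPiEquivProdPi_symm (X := fun _ : ι ⊕ ι' => κ → ℝ)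
    fun _ => stdNormalVec κ
  have h2 := measurePreserving_swap_pi (ι := ι ⊕ ι') (κ := κ) (gaussianReal 0 1)
  have e : (fun (p : (ι → κ → ℝ) × (ι' → κ → ℝ)) (k : κ) (s : ι ⊕ ι') => Sum.elim p.1 p.2 s k) =
      (fun x k i => x i k) ∘ (MeasurableEquiv.sumPiEquivProdPi fun _ => κ → ℝ).symm := by
    ext p k (s | s) <;> rfl
  rw [e]
  exact h2.comp h1

theorem measurable_matrix_apply {p q : ℕ} (i : Fin p) (j : Fin q) :
    Measurable fun S : Matrix (Fin p) (Fin q) ℝ => S i j :=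
  show Measurable fun S : Fin p → Fin q → ℝ => S i j by fun_prop

section

variable {r m : ℕ} {I J : Finset (Fin r)} (a : Fin m ≃ I) (b : Fin m ≃ J)

/-- The elements of `I` and `J`, listed in the orders `a` and `b`. -/
def jointListing : Fin m ⊕ Fin m → Fin r := Sum.elim (fun i => a i) (fun j => b j)

theorem measurable_det_blockOf :
    Measurable fun S : Matrix (Fin r) (Fin r) ℝ => (blockOf S a b).det := by
  simp only [det_apply', blockOf, submatrix_apply]
  exact Finset.measurable_sum _ fun σ _ => measurable_const.mul <|
    Finset.measurable_prod _ fun i _ => measurable_matrix_apply _ _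

theorem jointListing_injective (h : Disjoint I J) : Function.Injective (jointListing a b) := by
  rintro (i | i) (j | j) hij
  · simpa [jointListing, Subtype.ext_iff] using hij
  · exact (Finset.disjoint_left.1 h (a i).2 (by
      have : ((a i : Fin r)) = b j := hij
      rw [this]; exact (b j).2)).elim
  · exact (Finset.disjoint_left.1 h (a j).2 (by
      have : ((b i : Fin r)) = a j := hij
      rw [← this]; exact (b i).2)).elim
  · simpa [jointListing, Subtype.ext_iff] using hij

theorem submatrix_jointListing {Γ : Matrix (Fin r) (Fin r) ℝ} (hΓ : Γ.IsSymm) :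
    Γ.submatrix (jointListing a b) (jointListing a b) =
      fromBlocks (blockOf Γ a a) (blockOf Γ a b) (blockOf Γ a b)ᵀ (blockOf Γ b b) := by
  ext (i | i) (j | j)
  · rfl
  · rfl
  · exact (hΓ.apply _ _).symm
  · rfl

/-- The bijection onto `I ∪ J` given by the orders `a` and `b`. -/
noncomputable def jointEquiv (h : Disjoint I J) : Fin m ⊕ Fin m ≃ (I ∪ J : Finset (Fin r)) :=
  (Equiv.sumCongr a b).trans (Equiv.Finset.union I J h)

theorem principalBlock_submatrix_jointEquiv (h : Disjoint I J) (Γ : Matrix (Fin r) (Fin r) ℝ) :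
    (principalBlock Γ (I ∪ J)).submatrix (jointEquiv a b h) (jointEquiv a b h) =
      Γ.submatrix (jointListing a b) (jointListing a b) := by
  ext (i | i) (j | j) <;> rfl

theorem inverseBlock_eq_toBlocks₁₂ (h : Disjoint I J) (Γ : Matrix (Fin r) (Fin r) ℝ) :
    inverseBlock Γ a b = (Γ.submatrix (jointListing a b) (jointListing a b))⁻¹.toBlocks₁₂ := by
  rw [← principalBlock_submatrix_jointEquiv a b h, inv_submatrix_equiv]
  rfl

theorem det_principalBlock_union (h : Disjoint I J) (Γ : Matrix (Fin r) (Fin r) ℝ) :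
    (principalBlock Γ (I ∪ J)).det =
      (Γ.submatrix (jointListing a b) (jointListing a b)).det := by
  rw [← principalBlock_submatrix_jointEquiv a b h, det_submatrix_equiv_self]

/-- The selected coordinates of a column of `X` have the law of `M z` with `z` standard normal.
Collecting the columns gives `X_I = P U`, `X_J = R (C U + V)` in law, hence `S_{IJ} = P U (C U + V)ᵀ
Rᵀ`. -/
theorem map_det_blockOf_wishart (n : ℕ) {Γ : Matrix (Fin r) (Fin r) ℝ} (hΓ : Γ.PosSemidef)
    {P R C : Matrix (Fin m) (Fin m) ℝ}
    (h : Γ.submatrix (jointListing a b) (jointListing a b) =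
      fromBlocks P 0 (R * C) R * (fromBlocks P 0 (R * C) R)ᵀ) :
    (wishart n Γ).map (fun S => (blockOf S a b).det) =
      ((stdNormalMat (Fin m) (Fin n)).prod (stdNormalMat (Fin m) (Fin n))).map
        fun p => P.det * R.det * ((C * of p.1 + of p.2) * (of p.1)ᵀ).det := by
  set M := fromBlocks P 0 (R * C) R with hM
  -- `A` is the coordinate selection matrix, so `A Γ Aᵀ` is the joint covariance block.
  set A : Matrix (Fin m ⊕ Fin m) (Fin r) ℝ :=
    (1 : Matrix (Fin r) (Fin r) ℝ).submatrix (jointListing a b) id with hA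
  have hAΓ : A * Γ * Aᵀ = M * Mᵀ := by
    rw [← h]
    ext i j
    simp [hA, mul_apply, one_apply]
  have hAv (v : Fin r → ℝ) (s : Fin m ⊕ Fin m) : (A *ᵥ v) s = v (jointListing a b s) := by
    change ((1 : Matrix (Fin r) (Fin r) ℝ) *ᵥ v) (jointListing a b s) = _
    rw [one_mulVec]
  have hcol : Measurable fun x : Fin n → EuclideanSpace ℝ (Fin r) =>
      columnMatrix x * (columnMatrix x)ᵀ := by
    refine measurable_pi_lambda _ fun i => measurable_pi_lambda _ fun j => ?_
    simp only [mul_apply, columnMatrix, transpose_apply, of_apply]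
    fun_prop
  let g : (Fin n → Fin m ⊕ Fin m → ℝ) → ℝ := fun y =>
    (of fun i j => ∑ k, y k (Sum.inl i) * y k (Sum.inr j)).det
  have hg : Measurable g := Continuous.measurable (by fun_prop)
  have hfac : (fun S => (blockOf S a b).det) ∘ (fun x : Fin n → EuclideanSpace ℝ (Fin r) =>
      columnMatrix x * (columnMatrix x)ᵀ) = g ∘ fun x k => A *ᵥ (x k).ofLp := by
    ext x
    simp only [Function.comp_apply, g]
    congr 1
    ext i j
    simp [blockOf, columnMatrix, mul_apply, hAv, jointListing]
  have hY : (Measure.pi fun _ : Fin n => multivariateGaussian (0 : EuclideanSpace ℝ (Fin r)) Γ).map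
      (fun x k => A *ᵥ (x k).ofLp) =
      (stdNormalMat (Fin n) (Fin m ⊕ Fin m)).map fun z k => M *ᵥ z k := by
    have h1 : IsProbabilityMeasure ((multivariateGaussian (0 : EuclideanSpace ℝ (Fin r)) Γ).map
      (fun x => A *ᵥ x.ofLp)) := Measure.isProbabilityMeasure_map (by fun_prop)
    have h2 : IsProbabilityMeasure ((stdNormalVec (Fin m ⊕ Fin m)).map (M *ᵥ ·)) :=
      Measure.isProbabilityMeasure_map (by fun_prop)
    rw [Measure.pi_map_pi (f := fun (_ : Fin n) (x : EuclideanSpace ℝ (Fin r)) => A *ᵥ x.ofLp)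
        fun _ => by fun_prop, stdNormalMat,
      Measure.pi_map_pi (f := fun (_ : Fin n) (z : Fin m ⊕ Fin m → ℝ) => M *ᵥ z)
        fun _ => by fun_prop, map_mulVec_multivariateGaussian hΓ hAΓ]
  have hA' : Measurable fun (x : Fin n → EuclideanSpace ℝ (Fin r)) k => A *ᵥ (x k).ofLp :=
    Continuous.measurable (by fun_prop)
  have hM' : Measurable fun (z : Fin n → Fin m ⊕ Fin m → ℝ) k => M *ᵥ z k :=
    Continuous.measurable (by fun_prop)
  have hmp := measurePreserving_sumElim_swap_stdNormalMat (Fin m) (Fin m) (Fin n)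
  rw [wishart, Measure.map_map (measurable_det_blockOf a b) hcol, hfac, ← Measure.map_map hg hA',
    hY, Measure.map_map hg hM', ← hmp.map_eq, Measure.map_map (hg.comp hM') hmp.measurable]
  congr 1
  ext ⟨U, V⟩
  have hU : (of fun i j => ∑ k, (M *ᵥ fun s => Sum.elim U V s k) (Sum.inl i) *
      (M *ᵥ fun s => Sum.elim U V s k) (Sum.inr j)) =
      P * ((C * of U + of V) * (of U)ᵀ)ᵀ * Rᵀ := by
    have e : P * ((C * of U + of V) * (of U)ᵀ)ᵀ * Rᵀ =
        (P * of U) * ((R * C) * of U + R * of V)ᵀ := by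
      rw [transpose_mul, transpose_transpose, Matrix.mul_assoc R, ← Matrix.mul_add,
        transpose_mul R]
      simp only [Matrix.mul_assoc]
    rw [e]
    ext i j
    have s1 (k : Fin n) : (fun s => Sum.elim U V s k) =
        Sum.elim (fun l => U l k) (fun l => V l k) := by
      ext (s | s) <;> rfl
    simp only [s1, hM, fromBlocks_mulVec]
    rw [mul_apply]
    simp only [of_apply]
    refine Finset.sum_congr rfl fun k _ => ?_
    simp [mul_apply, mulVec, dotProduct]
  change (of fun i j => ∑ k, (M *ᵥ fun s => Sum.elim U V s k) (Sum.inl i) *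
      (M *ᵥ fun s => Sum.elim U V s k) (Sum.inr j)).det = _
  rw [hU, det_mul, det_mul, det_transpose, det_transpose]
  ring

end

/-! ### Assembly of the variance -/

theorem cast_factorial_div_factorial_sub {n k : ℕ} (h : k ≤ n) :
    (n ! : ℝ) / ((n - k)! : ℝ) = n.descFactorial k := by
  rw [div_eq_iff (by positivity), mul_comm]
  exact_mod_cast (Nat.factorial_mul_descFactorial h).symm

theorem proposition5p5 {Ω : Type*} [MeasurableSpace Ω] (P : Measure Ω) [IsProbabilityMeasure P]
    {r n m : ℕ} (hm : 1 ≤ m) (hmn : m ≤ n)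
    (Γ : Matrix (Fin r) (Fin r) ℝ) (hΓ : Γ.PosDef)
    (S : Ω → Matrix (Fin r) (Fin r) ℝ) (hS : HasLaw S (wishart n Γ) P)
    (I J : Finset (Fin r)) (hIJ : Disjoint I J) (a : Fin m ≃ I) (b : Fin m ≃ J) :
    MemLp (fun ω => (blockOf (S ω) a b).det) 2 P ∧
    variance (fun ω => (blockOf (S ω) a b).det) P =
      ((n ! : ℝ) / ((n - m)! : ℝ)) * (blockOf Γ a b).det ^ 2 *
          (((n + 2)! : ℝ) / ((n + 2 - m)! : ℝ) - (n ! : ℝ) / ((n - m)! : ℝ)) +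
        ((n ! : ℝ) / ((n - m)! : ℝ)) * (principalBlock Γ (I ∪ J)).det *
          ∑ k ∈ Finset.range m,
            ((m - k)! : ℝ) * (((n + 2)! : ℝ) / ((n + 2 - k)! : ℝ)) * (-1) ^ k *
              (compound k (blockOf Γ b a * inverseBlock Γ a b)).trace := by
  have hsymm : Γ.IsSymm := by
    simpa [IsSymm, IsHermitian, conjTranspose_eq_transpose_of_trivial] using hΓ.isHermitian
  have hpos := hΓ.submatrix (jointListing_injective a b hIJ)
  have hblock := submatrix_jointListing a b hsymm
  rw [hblock] at hpos
  obtain ⟨B, R, C, l, hfac, hl, hminor⟩ := exists_block_factorization hpos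
  have hba : (blockOf Γ a b)ᵀ = blockOf Γ b a := by
    ext i j; exact hsymm.apply _ _
  rw [← hblock, hba, ← inverseBlock_eq_toBlocks₁₂ a b hIJ] at hminor
  have hdet : (principalBlock Γ (I ∪ J)).det = (B.det * R.det) ^ 2 := by
    rw [det_principalBlock_union a b hIJ, hblock, hfac, det_mul, det_transpose,
      det_fromBlocks_zero₁₂]
    ring
  have hdetab : (blockOf Γ a b).det = B.det * R.det * C.det := by
    rw [fromBlocks_transpose, fromBlocks_multiply] at hfac
    have := (fromBlocks_inj.1 hfac).2.1
    rw [this]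
    simp [det_mul]
    ring
  set F : (Fin m → Fin n → ℝ) × (Fin m → Fin n → ℝ) → ℝ :=
    fun p => B.det * R.det * ((C * of p.1 + of p.2) * (of p.1)ᵀ).det with hF
  set ν := (stdNormalMat (Fin m) (Fin n)).prod (stdNormalMat (Fin m) (Fin n))
  have hFm : HasMoments F ν :=
    (HasMoments.const _).mul (hasMoments_det_mul_add_mul_transpose C)
  have hlaw : P.map (fun ω => (blockOf (S ω) a b).det) = ν.map F := by
    rw [← map_det_blockOf_wishart a b n hΓ.posSemidef (hblock.trans hfac), ← hS.map_eq,
      AEMeasurable.map_map_of_aemeasurable (measurable_det_blockOf a b).aemeasurable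
        hS.aemeasurable]
    rfl
  have hfP : AEMeasurable (fun ω => (blockOf (S ω) a b).det) P :=
    (measurable_det_blockOf a b).comp_aemeasurable hS.aemeasurable
  have hFν : AEMeasurable F ν := hFm.integrable.aemeasurable
  have hmem : MemLp id 2 (ν.map F) :=
    (memLp_map_measure_iff aestronglyMeasurable_id hFν).2 hFm.memLp_two
  refine ⟨?_, ?_⟩
  · rw [← hlaw] at hmem
    exact (memLp_map_measure_iff aestronglyMeasurable_id hfP).1 hmem
  have hvar : variance (fun ω => (blockOf (S ω) a b).det) P = variance F ν := by
    have h1 := variance_map (X := id) aemeasurable_id hfP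
    rw [hlaw, variance_map aemeasurable_id hFν] at h1
    exact h1.symm
  have h1 : ∫ p, F p ∂ν = n.descFactorial m * (blockOf Γ a b).det := by
    rw [hF, integral_const_mul, integral_prod_det_mul_add_mul_transpose, hdetab]
    simp only [Fintype.card_fin]
    ring
  have h2 : ∫ p, F p ^ 2 ∂ν = (principalBlock Γ (I ∪ J)).det * (n.descFactorial m *
      ∑ k ∈ Finset.range (m + 1), ((m - k)! : ℝ) * (n + 2).descFactorial k *
        minorSum k (Cᵀ * C)) := by
    simp only [hF, mul_pow _ (det _)]
    rw [integral_const_mul, integral_prod_det_mul_add_mul_transpose_sq hl, hdet]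
    simp only [Fintype.card_fin]
    ring
  -- The top term of the second moment: multiplied by `det(Σ_{IJ×IJ}) = (det B · det R)²` it becomes
  -- `det(Σ_{IJ})²`, so it leaves the sum and joins the squared mean.
  have hmm : minorSum m (Cᵀ * C) = C.det ^ 2 := by
    have := minorSum_card (Cᵀ * C)
    rw [Fintype.card_fin] at this
    rw [this, det_mul, det_transpose, pow_two]
  have hsum : ∑ k ∈ Finset.range m, ((m - k)! : ℝ) * (((n + 2)! : ℝ) / ((n + 2 - k)! : ℝ)) *
        (-1) ^ k * (compound k (blockOf Γ b a * inverseBlock Γ a b)).trace =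
      ∑ k ∈ Finset.range m, ((m - k)! : ℝ) * (n + 2).descFactorial k * minorSum k (Cᵀ * C) := by
    refine Finset.sum_congr rfl fun k hk => ?_
    have hk' : k ≤ n + 2 := by have := Finset.mem_range.1 hk; omega
    rw [cast_factorial_div_factorial_sub hk', trace_compound_eq_minorSum, hminor]
    ring
  rw [hvar, variance_eq_sub hFm.memLp_two, hsum, cast_factorial_div_factorial_sub hmn,
    cast_factorial_div_factorial_sub (by omega : m ≤ n + 2)]
  simp only [Pi.pow_apply]
  rw [h1, h2, Finset.sum_range_succ, hmm, hdetab, hdet]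
  simp only [Nat.sub_self, Nat.factorial_zero, Nat.cast_one]
  ring
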